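/- Let $d\ge 1$, let $\mathcal Z=\prod_{i=1}^d [c_i^-,c_i^+]\subset\mathbb R^d$ be a product of compact intervals, and let $\widetilde{\mathcal Z}\supset\mathcal Z$ be a closed ball of radius $R>0$ centred at the origin. Let $f(x,y)=\sum_{i=1}^d\alpha_i f_i(x^{(i)},y^{(i)})$ for $x,y\in\widetilde{\mathcal Z}$, where, for each $i$, $\alpha_i>0$, the function $f_i:[-R,R]^2\to\mathbb R$ is a positive definite kernel (symmetric, with $\sum_{j,k}a_ja_kf_i(s_j,s_k)\ge 0$ for all finite families $s_j\in[-R,R]$, $a_j\in\mathbb R$) and is $C^2$ (up to the boundary), and $$h_i(z):=\left.\frac{\partial^2 f_i}{\partial x\,\partial y}\right|_{(z,z)}>0\qquad\text{for all } z\in[c_i^-,c_i^+].$$ Assume that for all $x\ne y$ in $\mathcal Z$ there is $a\in\mathcal Z$ with $f(x,a)\ne f(y,a)$. Let $f(x,y)=\sum_{k\ge1}\lambda_ku_k(x)u_k(y)$ be a Mercer expansion of $f$ on $\widetilde{\mathcal Z}$, that is, $\lambda_k\ge 0$, the functions $u_k$ are orthonormal in $L^2(\widetilde{\mathcal Z})$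 for Lebesgue measure, and the series converges absolutely and uniformly on $\widetilde{\mathcal Z}\times\widetilde{\mathcal Z}$. Let $\phi(x)=(\lambda_k^{1/2}u_k(x))_{k\ge1}\in\ell_2$ and $\mathcal M=\phi(\mathcal Z)$. The geodesic distance in a set $S$ (a subset of $\ell_2$ or of $\mathbb R^d$) between two of its points is the infimum of the lengths of the continuous paths $[0,1]\to S$ joining them, where the length of a path is the supremum over partitions of $[0,1]$ of the sum of the distances between successive points. Define $\psi(z)=(\psi_1(z^{(1)}),\dots,\psi_d(z^{(d)}))$ with $$\psi_i(s)=\alpha_i^{1/2}\int_{c_i^-}^{s}h_i(\xi)^{1/2}\,\mathrm d\xi .$$ Then each $\psi_i$ is strictly increasing on $[c_i^-,c_i^+]$, and for all $z,w\in\mathcal Z$ the geodesic distance in $\mathcal M$ between $\phi(z)$ and $\phi(w)$ equals $\|\psi(z)-\psi(w)\|$. If moreover there is a constant $c>0$ such that $\alpha_ih_i(z)=c$ for all $i$ and all $z\in[c_i^-,c_i^+]$, then for all $z,w\in\mathcal Z$ the geodesic distance in $\mathcal M$ between $\phi(z)$ and $\phi(w)$ equals $\sqrt c$ times the geodesic distance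 in $\mathcal Z$ between $z$ and $w$, and the latter equals $\|z-w\|$. -/

import Mathlib

open Set Metric MeasureTheory Filter
open scoped ENNReal

/-- The real sequence space `ℓ₂` with its usual norm. -/
abbrev EllTwo : Type := lp (fun _ : ℕ => ℝ) 2

/-- Symmetric nonnegative-definite (that is, positive-definite in the sense of kernels) functions
on `S × S`. -/
def IsPosDefKernelOn {X : Type*} (S : Set X) (k : X → X → ℝ) : Prop :=
  (∀ x ∈ S, ∀ y ∈ S, k x y = k y x) ∧
    ∀ (n : ℕ) (x : Fin n → X), (∀ i, x i ∈ S) → ∀ a : Fin n → ℝ,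
      0 ≤ ∑ i, ∑ j, a i * a j * k (x i) (x j)

/-- A Mercer expansion `f(x,y) = ∑ₖ λₖ uₖ(x) uₖ(y)` of `f` on `S × S`, where `S` is the closed
ball of radius `R` centred at the origin: nonnegative `λₖ`, functions `uₖ` that are orthonormal in
`L²(S)` for Lebesgue measure, and absolute and uniform convergence. -/
structure MercerExpansion {d : ℕ} (R : ℝ)
    (f : EuclideanSpace ℝ (Fin d) → EuclideanSpace ℝ (Fin d) → ℝ) where
  /-- The eigenvalues. -/
  eig : ℕ → ℝ
  /-- The eigenfunctions; only their values on the ball matter. -/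
  u : ℕ → EuclideanSpace ℝ (Fin d) → ℝ
  eig_nonneg : ∀ k, 0 ≤ eig k
  memLp : ∀ k, MemLp (u k) 2 (volume.restrict (closedBall 0 R))
  orthonormal : ∀ j k, ∫ x in closedBall 0 R, u j x * u k x = if j = k then 1 else 0
  summable_abs : ∀ x ∈ closedBall 0 R, ∀ y ∈ closedBall 0 R,
    Summable fun k => |eig k * u k x * u k y|
  tendstoUniformlyOn : TendstoUniformlyOn
    (fun (n : ℕ) (p : EuclideanSpace ℝ (Fin d) × EuclideanSpace ℝ (Fin d)) =>
      ∑ k ∈ Finset.range n, eig k * u k p.1 * u k p.2)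
    (fun p => f p.1 p.2) atTop (closedBall 0 R ×ˢ closedBall 0 R)

namespace MercerExpansion

variable {d : ℕ} {R : ℝ} {f : EuclideanSpace ℝ (Fin d) → EuclideanSpace ℝ (Fin d) → ℝ}

theorem memℓp (m : MercerExpansion R f) {x : EuclideanSpace ℝ (Fin d)}
    (hx : x ∈ closedBall 0 R) :
    Memℓp (fun k => √(m.eig k) * m.u k x) 2 := by
  rw [memℓp_gen_iff (by norm_num)]
  refine (m.summable_abs x hx x hx).congr fun k => ?_
  have h := m.eig_nonneg k
  have h1 : 0 ≤ m.eig k * m.u k x * m.u k x := by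
    rw [mul_assoc]; exact mul_nonneg h (mul_self_nonneg _)
  rw [abs_of_nonneg h1]
  simp only [ENNReal.toReal_ofNat, Real.norm_eq_abs, Real.rpow_ofNat, sq_abs, mul_pow,
    Real.sq_sqrt h]
  ring

/-- The Mercer feature map `φ(x) = (λₖ^{1/2} uₖ(x))ₖ`. -/
noncomputable def featureMap (m : MercerExpansion R f)
    (x : closedBall (0 : EuclideanSpace ℝ (Fin d)) R) : EllTwo :=
  ⟨fun k => √(m.eig k) * m.u k x, m.memℓp x.2⟩

/-- The image `ℳ = φ(Z)`. -/
def manifold (m : MercerExpansion R f) (Z : Set (EuclideanSpace ℝ (Fin d))) : Set EllTwo :=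
  m.featureMap '' {x | (x : EuclideanSpace ℝ (Fin d)) ∈ Z}

end MercerExpansion

/-- The geodesic distance in `M` between `a` and `b`: the infimum of the lengths of the continuous
paths `[0,1] → M` from `a` to `b`, where the length is the supremum over all partitions of the sums
of the distances between successive points (`∞` if there is no path of finite length). -/
noncomputable def geodesicDist {X : Type*} [PseudoEMetricSpace X] (M : Set X) (a b : X) : ℝ≥0∞ :=
  ⨅ (γ : Path a b) (_ : ∀ t, γ t ∈ M), eVariationOn γ univ

/-- The product of the intervals `[cm i, cp i]`. -/
def intervalBox {d : ℕ} (cm cp : Fin d → ℝ) : Set (EuclideanSpace ℝ (Fin d)) :=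
  {z | ∀ i, z i ∈ Icc (cm i) (cp i)}

/-- `f(x,y) = ∑ᵢ αᵢ fᵢ(xᵢ, yᵢ)`. -/
noncomputable def additiveKernel {d : ℕ} (α : Fin d → ℝ) (f : Fin d → ℝ → ℝ → ℝ)
    (x y : EuclideanSpace ℝ (Fin d)) : ℝ :=
  ∑ i, α i * f i (x i) (y i)

/-- The mixed partial derivative `∂²g/∂x∂y` at `(z,z)` of a function `g` on the square
`[-R,R] × [-R,R]` (one-sided where `z = R` or `z = -R`). -/
noncomputable def diagMixedPartial (R : ℝ) (g : ℝ → ℝ → ℝ) (z : ℝ) : ℝ :=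
  derivWithin (fun x => derivWithin (fun y => g x y) (Icc (-R) R) z) (Icc (-R) R) z

/-- The one-dimensional transformation `s ↦ a^{1/2} ∫_c^s (∂²g/∂x∂y (ξ,ξ))^{1/2} dξ`. -/
noncomputable def coordTransform (R a : ℝ) (g : ℝ → ℝ → ℝ) (c s : ℝ) : ℝ :=
  √a * ∫ ξ in c..s, √(diagMixedPartial R g ξ)

/-- The coordinatewise transformation `ψ(z) = (ψ₁(z₁), …, ψ_d(z_d))`. -/
noncomputable def transform {d : ℕ} (R : ℝ) (α : Fin d → ℝ) (f : Fin d → ℝ → ℝ → ℝ)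
    (cm : Fin d → ℝ) (z : EuclideanSpace ℝ (Fin d)) : EuclideanSpace ℝ (Fin d) :=
  WithLp.toLp 2 fun i => coordTransform R (α i) (f i) (cm i) (z i)

/-! The Mercer expansion gives `⟪φ x, φ y⟫ = f x y`, so `‖φ x - φ y‖²` is the sum over `i` of `αᵢ`
times the second difference of `fᵢ` on the square with corners `xᵢ, yᵢ`. By the mean value theorem
this second difference is `(xᵢ - yᵢ)²` times a mixed partial at a nearby point, while the squared
increment of `ψᵢ` is `αᵢ (xᵢ - yᵢ)² hᵢ(ζ)`. As `hᵢ` is bounded below on a compact interval, the two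
agree up to a factor `1 + ε`, uniformly for close points (`exists_delta_dist_featureMap_transform`).

Such a comparison passes to lengths without differentiating `φ` or any path. Both maps are
embeddings of the compact box: a path in `ℳ` lifts to the box and a fine subdivision bounds its
length below (`edist_le_geodesicDist_range`). The image of `ψ` is again a box, hence convex, so
segments pull back to nearly optimal paths (`geodesicDist_range_le_edist`). Letting `ε → 0` gives
equality. -/

open scoped Topology unitInterval

/-! ### Lengths of Lipschitz curves -/

theorem lipschitzWith_of_local {E : Type*} [PseudoMetricSpace E] {g : ℝ → E} {η C : ℝ} (hη : 0 < η)
    (h : ∀ s t, dist s t < η → dist (g s) (g t) ≤ C * dist s t) (s t : ℝ) :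
    dist (g s) (g t) ≤ C * dist s t := by
  -- With `n` equal pieces each has length below `η`, so the local bound applies to every piece.
  obtain ⟨n, hn⟩ := exists_nat_gt (dist s t / η)
  have hn0 : (0 : ℝ) < n := lt_of_le_of_lt (by positivity) hn
  set u : ℕ → ℝ := fun k => s + k * ((t - s) / n) with hu
  have hstep : ∀ k, dist (u k) (u (k + 1)) = dist s t / n := by
    intro k
    have : u k - u (k + 1) = (s - t) / n := by simp only [hu]; push_cast; ring
    rw [Real.dist_eq, this, abs_div, Real.dist_eq, abs_of_pos hn0]
  have hlt : dist s t / n < η := by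
    rw [div_lt_iff₀ hη] at hn
    rw [div_lt_iff₀ hn0]; linarith
  have h0 : u 0 = s := by simp [hu]
  have h1 : u n = t := by simp only [hu]; field_simp; ring
  calc dist (g s) (g t) = dist (g (u 0)) (g (u n)) := by rw [h0, h1]
    _ ≤ ∑ k ∈ Finset.range n, dist (g (u k)) (g (u (k + 1))) :=
        dist_le_range_sum_dist (fun k => g (u k)) n
    _ ≤ ∑ _k ∈ Finset.range n, C * (dist s t / n) := by
        refine Finset.sum_le_sum fun k _ => ?_
        rw [← hstep k]
        exact h _ _ (by rw [hstep k]; exact hlt)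
    _ = C * dist s t := by
        rw [Finset.sum_const, Finset.card_range, nsmul_eq_mul]
        field_simp

theorem eVariationOn_univ_le_of_lipschitz {E : Type*} [PseudoMetricSpace E] {g : ℝ → E}
    {C : NNReal} (h : LipschitzWith C g) : eVariationOn (fun t : I => g t) univ ≤ C := by
  have h1 := (h.lipschitzOnWith (s := univ)).comp_eVariationOn_le
    (f := g) (g := fun t : I => (t : ℝ)) (s := univ) (fun _ _ => mem_univ _)
  refine h1.trans ?_
  have h2 : eVariationOn (fun t : I => (t : ℝ)) univ ≤ 1 := by
    have := MonotoneOn.eVariationOn_eq (f := fun t : I => (t : ℝ)) (s := univ)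
      (fun a _ b _ hab => hab) (mem_univ 0) (mem_univ 1)
    have h3 : univ ∩ Icc (0 : I) 1 = univ := by
      exact (univ_inter _).trans (eq_univ_of_forall fun t => ⟨t.2.1, t.2.2⟩)
    rw [h3] at this
    rw [this]; simp
  calc (C : ℝ≥0∞) * _ ≤ C * 1 := by gcongr
    _ = C := mul_one _

theorem ENNReal.le_of_forall_one_add_mul {a b : ℝ≥0∞}
    (h : ∀ ε : ℝ, 0 < ε → a ≤ ENNReal.ofReal (1 + ε) * b) : a ≤ b := by
  have h1 : Tendsto (fun ε : ℝ => ENNReal.ofReal (1 + ε) * b) (𝓝[>] 0) (𝓝 (1 * b)) := by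
    -- The limit factor `1` is nonzero, so the product converges even when `b = ∞`.
    refine ENNReal.Tendsto.mul_const ?_ (Or.inl one_ne_zero)
    have : Tendsto (fun ε : ℝ => ENNReal.ofReal (1 + ε)) (𝓝 0) (𝓝 (ENNReal.ofReal (1 + 0))) :=
      (ENNReal.continuous_ofReal.comp (continuous_const.add continuous_id)).tendsto 0
    simpa using this.mono_left nhdsWithin_le_nhds
  rw [one_mul] at h1
  exact ge_of_tendsto h1 (by filter_upwards [self_mem_nhdsWithin] with ε hε using h ε hε)

/-! ### From local distance comparison to geodesic distance -/

section Infinitesimal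

variable {X E F : Type*} [MetricSpace X] [CompactSpace X] [MetricSpace E]

/-- If `ψ` is locally at most a factor `1 + ε` longer than a topological embedding `φ`, then paths
in the image of `φ` are at least as long as the `ψ`-distance of their endpoints. -/
theorem edist_le_geodesicDist_range [PseudoMetricSpace F] {φ : X → E} {ψ : X → F}
    (hφ : Continuous φ) (hinj : Function.Injective φ)
    (h : ∀ ε : ℝ, 0 < ε → ∃ δ > 0, ∀ x y, dist x y < δ →
      dist (ψ x) (ψ y) ≤ (1 + ε) * dist (φ x) (φ y)) (z w : X) :
    edist (ψ z) (ψ w) ≤ geodesicDist (range φ) (φ z) (φ w) := by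
  refine le_iInf₂ fun γ hγ => ENNReal.le_of_forall_one_add_mul fun ε hε => ?_
  obtain ⟨δ, hδ, hδ'⟩ := h ε hε
  -- By compactness `φ` is an embedding, so `γ` lifts to a continuous path `x` in `X`.
  have hemb : Topology.IsEmbedding φ := (hφ.isClosedEmbedding hinj).isEmbedding
  choose x hx using hγ
  have hxc : Continuous x := by
    rw [hemb.continuous_iff]
    have : φ ∘ x = γ := funext hx
    rw [this]; exact γ.continuous
  obtain ⟨η, hη, hη'⟩ := Metric.uniformContinuous_iff.1
    (CompactSpace.uniformContinuous_of_continuous hxc) δ hδ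
  obtain ⟨n, hn⟩ := exists_nat_gt (1 / η)
  have hn0 : (0 : ℝ) < n := lt_of_le_of_lt (by positivity) hn
  -- Clamping makes `u` monotone on all of `ℕ`, as the bound by the variation requires.
  set u : ℕ → I := fun k => projIcc 0 1 zero_le_one ((k : ℝ) / n) with hu
  have hmono : Monotone u := fun j k hjk => monotone_projIcc _ (by gcongr)
  have h0 : u 0 = 0 := by simp [hu]
  have h1 : u n = 1 := by simp [hu, hn0.ne']
  have hstep : ∀ k, dist (u k) (u (k + 1)) < η := by
    intro k
    refine lt_of_le_of_lt (abs_projIcc_sub_projIcc _) ?_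
    have : ((k : ℝ) / n - (k + 1 : ℕ) / n) = -(1 / n) := by push_cast; ring
    rw [this, abs_neg, abs_of_pos (by positivity)]
    exact (one_div_lt hη hn0).1 hn
  have hz : x 0 = z := hinj (by rw [hx, γ.source])
  have hw : x 1 = w := hinj (by rw [hx, γ.target])
  calc edist (ψ z) (ψ w) = edist (ψ (x (u 0))) (ψ (x (u n))) := by rw [h0, h1, hz, hw]
    _ ≤ ∑ k ∈ Finset.range n, edist (ψ (x (u k))) (ψ (x (u (k + 1)))) :=
        edist_le_range_sum_edist (fun k => ψ (x (u k))) n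
    _ ≤ ∑ k ∈ Finset.range n, ENNReal.ofReal (1 + ε) * edist (γ (u (k + 1))) (γ (u k)) := by
        refine Finset.sum_le_sum fun k _ => ?_
        rw [edist_dist, edist_dist, ← ENNReal.ofReal_mul (by positivity),
          dist_comm (γ _), ← hx, ← hx]
        exact ENNReal.ofReal_le_ofReal (hδ' _ _ (hη' (hstep k)))
    _ = ENNReal.ofReal (1 + ε) * ∑ k ∈ Finset.range n, edist (γ (u (k + 1))) (γ (u k)) := by
        rw [Finset.mul_sum]
    _ ≤ ENNReal.ofReal (1 + ε) * eVariationOn γ univ := by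
        gcongr
        exact eVariationOn.sum_le (f := γ) (n := n) hmono (fun _ => mem_univ _)

/-- If `φ` is locally at most a factor `1 + ε` longer than an embedding `ψ` with convex image, then
pulling back segments gives paths in the image of `φ` that are no longer than the segments. -/
theorem geodesicDist_range_le_edist [NormedAddCommGroup F] [NormedSpace ℝ F] {φ : X → E} {ψ : X → F}
    (hφ : Continuous φ) (hψ : Continuous ψ) (hinj : Function.Injective ψ)
    (hconv : Convex ℝ (range ψ))
    (h : ∀ ε : ℝ, 0 < ε → ∃ δ > 0, ∀ x y, dist x y < δ →
      dist (φ x) (φ y) ≤ (1 + ε) * dist (ψ x) (ψ y)) (z w : X) :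
    geodesicDist (range φ) (φ z) (φ w) ≤ edist (ψ z) (ψ w) := by
  have hemb : Topology.IsEmbedding ψ := (hψ.isClosedEmbedding hinj).isEmbedding
  have hline : ∀ t : I, AffineMap.lineMap (ψ z) (ψ w) (t : ℝ) ∈ range ψ := fun t =>
    hconv.lineMap_mem (mem_range_self z) (mem_range_self w) t.2
  choose x hx using hline
  have hxc : Continuous x := by
    rw [hemb.continuous_iff]
    have : ψ ∘ x = fun t : I => AffineMap.lineMap (ψ z) (ψ w) (t : ℝ) := funext hx
    rw [this]
    exact AffineMap.lineMap_continuous.comp continuous_subtype_val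
  have hz : x 0 = z := hinj (by rw [hx]; simp)
  have hw : x 1 = w := hinj (by rw [hx]; simp)
  let γ : Path (φ z) (φ w) := ⟨⟨φ ∘ x, hφ.comp hxc⟩, by simp [hz], by simp [hw]⟩
  refine (iInf₂_le γ fun t => mem_range_self (x t)).trans
    (ENNReal.le_of_forall_one_add_mul fun ε hε => ?_)
  obtain ⟨δ, hδ, hδ'⟩ := h ε hε
  obtain ⟨η, hη, hη'⟩ := Metric.uniformContinuous_iff.1
    (CompactSpace.uniformContinuous_of_continuous hxc) δ hδ
  -- The path is extended by constants to `ℝ`. Clamping is 1-Lipschitz and the segment has speed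
  -- `dist (ψ z) (ψ w)`, whence the Lipschitz constant below.
  set g : ℝ → E := fun t => φ (x (projIcc 0 1 zero_le_one t)) with hg
  have hlip : ∀ s t, dist (g s) (g t) ≤ ((1 + ε) * dist (ψ z) (ψ w)) * dist s t := by
    refine lipschitzWith_of_local hη fun s t hst => ?_
    have hp : dist (projIcc (0 : ℝ) 1 zero_le_one s) (projIcc 0 1 zero_le_one t) ≤ dist s t :=
      abs_projIcc_sub_projIcc _
    refine (hδ' _ _ (hη' (hp.trans_lt hst))).trans ?_
    rw [hx, hx, dist_lineMap_lineMap, mul_assoc]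
    have : dist ((projIcc (0 : ℝ) 1 zero_le_one s : I) : ℝ) (projIcc (0 : ℝ) 1 zero_le_one t : I)
      ≤ dist s t := hp
    rw [mul_comm (dist (ψ z) (ψ w))]
    gcongr
  have hC : 0 ≤ (1 + ε) * dist (ψ z) (ψ w) := by positivity
  have hL : LipschitzWith ((1 + ε) * dist (ψ z) (ψ w)).toNNReal g :=
    LipschitzWith.of_dist_le_mul fun s t => by
      rw [Real.coe_toNNReal _ hC]; exact hlip s t
  have hγ : (γ : I → E) = fun t : I => g t := by
    funext t
    simp [γ, hg]
  rw [hγ, edist_dist, ← ENNReal.ofReal_mul (by positivity)]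
  exact eVariationOn_univ_le_of_lipschitz hL

end Infinitesimal

/-! ### Mixed partials and second differences -/

section PartialDerivatives

variable {F : ℝ × ℝ → ℝ} {s t : Set ℝ} {x y : ℝ}

theorem hasDerivWithinAt_fst (hF : DifferentiableOn ℝ F (s ×ˢ t)) (hx : x ∈ s) (hy : y ∈ t) :
    HasDerivWithinAt (fun x' => F (x', y)) (fderivWithin ℝ F (s ×ˢ t) (x, y) (1, 0)) s x :=
  (hF (x, y) ⟨hx, hy⟩).hasFDerivWithinAt.comp_hasDerivWithinAt (f := fun x' => (x', y)) x
    ((hasDerivWithinAt_id x s).prodMk (hasDerivWithinAt_const x s y)) fun _ h => ⟨h, hy⟩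

theorem hasDerivWithinAt_snd (hF : DifferentiableOn ℝ F (s ×ˢ t)) (hx : x ∈ s) (hy : y ∈ t) :
    HasDerivWithinAt (fun y' => F (x, y')) (fderivWithin ℝ F (s ×ˢ t) (x, y) (0, 1)) t y :=
  (hF (x, y) ⟨hx, hy⟩).hasFDerivWithinAt.comp_hasDerivWithinAt (f := fun y' => (x, y')) y
    ((hasDerivWithinAt_const y t x).prodMk (hasDerivWithinAt_id y t)) fun _ h => ⟨hx, h⟩

/-- The mixed partial derivative `∂/∂x ∂/∂y` of `g` within `s × s`. -/
noncomputable def mixedPartialWithin (s : Set ℝ) (g : ℝ → ℝ → ℝ) (p : ℝ × ℝ) : ℝ :=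
  derivWithin (fun x => derivWithin (g x) s p.2) s p.1

variable {g : ℝ → ℝ → ℝ}

/-- The partial derivative is the Fréchet derivative applied to `(0, 1)`, so only one order of
smoothness is lost. -/
theorem contDiffOn_derivWithin_snd (hs : UniqueDiffOn ℝ s)
    (hg : ContDiffOn ℝ 2 (fun p : ℝ × ℝ => g p.1 p.2) (s ×ˢ s)) :
    ContDiffOn ℝ 1 (fun p : ℝ × ℝ => derivWithin (g p.1) s p.2) (s ×ˢ s) := by
  refine ((hg.fderivWithin (hs.prod hs) (by norm_num)).clm_apply
    (contDiffOn_const (c := ((0 : ℝ), (1 : ℝ))))).congr ?_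
  rintro ⟨x, y⟩ ⟨hx, hy⟩
  exact (hasDerivWithinAt_snd (hg.differentiableOn two_ne_zero) hx hy).derivWithin (hs y hy)

theorem continuousOn_mixedPartialWithin (hs : UniqueDiffOn ℝ s)
    (hg : ContDiffOn ℝ 2 (fun p : ℝ × ℝ => g p.1 p.2) (s ×ˢ s)) :
    ContinuousOn (mixedPartialWithin s g) (s ×ˢ s) := by
  have h1 := contDiffOn_derivWithin_snd hs hg
  refine ((h1.continuousOn_fderivWithin (hs.prod hs) le_rfl).clm_apply
    (continuousOn_const (c := ((1 : ℝ), (0 : ℝ))))).congr ?_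
  rintro ⟨x, y⟩ ⟨hx, hy⟩
  exact (hasDerivWithinAt_fst (h1.differentiableOn one_ne_zero) hx hy).derivWithin (hs x hx)

/-- The mean value theorem for second differences. -/
theorem exists_mixedPartialWithin_eq {a b : ℝ} (hs : UniqueDiffOn ℝ s)
    (hg : ContDiffOn ℝ 2 (fun p : ℝ × ℝ => g p.1 p.2) (s ×ˢ s)) (hab : a < b)
    (hsub : Icc a b ⊆ s) :
    ∃ ξ ∈ Icc a b, ∃ η ∈ Icc a b,
      g b b - g a b - (g b a - g a a) = (b - a) ^ 2 * mixedPartialWithin s g (ξ, η) := by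
  have ha : a ∈ s := hsub ⟨le_rfl, hab.le⟩
  have hb : b ∈ s := hsub ⟨hab.le, le_rfl⟩
  have hnhds : ∀ c ∈ Ioo a b, s ∈ nhds c := fun c hc =>
    mem_of_superset (Icc_mem_nhds hc.1 hc.2) hsub
  have hd := hg.differentiableOn two_ne_zero
  have h1 := (contDiffOn_derivWithin_snd hs hg).differentiableOn one_ne_zero
  have hy : ∀ x ∈ s, ∀ y ∈ s, HasDerivWithinAt (g x) (derivWithin (g x) s y) s y :=
    fun x hx y hy => (hasDerivWithinAt_snd hd hx hy).differentiableWithinAt.hasDerivWithinAt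
  -- The mean value theorem in `y` for `g b - g a` fixes `η`; it is then used in `x` for the
  -- `y`-derivative at height `η`.
  obtain ⟨η, hη, hη'⟩ := exists_hasDerivAt_eq_slope (fun y => g b y - g a y)
    (fun y => derivWithin (g b) s y - derivWithin (g a) s y) hab
    (fun y h => (((hy b hb y (hsub h)).sub (hy a ha y (hsub h))).continuousWithinAt).mono hsub)
    (fun y h => ((hy b hb y (hsub (Ioo_subset_Icc_self h))).sub
      (hy a ha y (hsub (Ioo_subset_Icc_self h)))).hasDerivAt (hnhds y h))
  have hηs := hsub (Ioo_subset_Icc_self hη)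
  have hx : ∀ x ∈ s, HasDerivWithinAt (fun x => derivWithin (g x) s η)
      (mixedPartialWithin s g (x, η)) s x := fun x hx =>
    (hasDerivWithinAt_fst h1 hx hηs).differentiableWithinAt.hasDerivWithinAt
  obtain ⟨ξ, hξ, hξ'⟩ := exists_hasDerivAt_eq_slope (fun x => derivWithin (g x) s η)
    (fun x => mixedPartialWithin s g (x, η)) hab
    (fun x h => ((hx x (hsub h)).continuousWithinAt).mono hsub)
    (fun x h => (hx x (hsub (Ioo_subset_Icc_self h))).hasDerivAt (hnhds x h))
  refine ⟨ξ, Ioo_subset_Icc_self hξ, η, Ioo_subset_Icc_self hη, ?_⟩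
  have hba : b - a ≠ 0 := sub_ne_zero.2 hab.ne'
  rw [eq_div_iff hba] at hη' hξ'
  rw [sq, mul_assoc, mul_comm (b - a) (mixedPartialWithin _ _ _), hξ', mul_comm, hη']

end PartialDerivatives

/-! ### The one-dimensional comparison -/

section CoordTransform

variable {R a c e : ℝ} {g : ℝ → ℝ → ℝ}

theorem continuousOn_diagMixedPartial (hR : 0 < R)
    (hg : ContDiffOn ℝ 2 (fun p : ℝ × ℝ => g p.1 p.2) (Icc (-R) R ×ˢ Icc (-R) R)) :
    ContinuousOn (diagMixedPartial R g) (Icc (-R) R) :=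
  (continuousOn_mixedPartialWithin (uniqueDiffOn_Icc (by linarith)) hg).comp
    (continuous_id.prodMk continuous_id).continuousOn fun _ h => ⟨h, h⟩

theorem coordTransform_sub (h : ContinuousOn (diagMixedPartial R g) (Icc c e)) {s t : ℝ}
    (hs : s ∈ Icc c e) (ht : t ∈ Icc c e) :
    coordTransform R a g c t - coordTransform R a g c s =
      √a * ∫ ξ in s..t, √(diagMixedPartial R g ξ) := by
  have hc : c ∈ Icc c e := ⟨le_rfl, hs.1.trans hs.2⟩
  have hi : ∀ {p q : ℝ}, p ∈ Icc c e → q ∈ Icc c e →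
      IntervalIntegrable (fun ξ => √(diagMixedPartial R g ξ)) volume p q := fun hp hq =>
    (h.sqrt.mono (ordConnected_Icc.uIcc_subset hp hq)).intervalIntegrable
  rw [coordTransform, coordTransform, ← mul_sub,
    intervalIntegral.integral_interval_sub_left (hi hc ht) (hi hc hs)]

theorem exists_coordTransform_sub_eq (h : ContinuousOn (diagMixedPartial R g) (Icc c e)) {s t : ℝ}
    (hs : s ∈ Icc c e) (ht : t ∈ Icc c e) (hst : s < t) :
    ∃ ζ ∈ Icc s t, coordTransform R a g c t - coordTransform R a g c s =
      √a * √(diagMixedPartial R g ζ) * (t - s) := by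
  have hsub : uIcc s t ⊆ Icc c e := ordConnected_Icc.uIcc_subset hs ht
  obtain ⟨ζ, hζ, hζ'⟩ := exists_eq_interval_average hst.ne (h.sqrt.mono hsub)
  rw [uIoo_of_le hst.le] at hζ
  refine ⟨ζ, Ioo_subset_Icc_self hζ, ?_⟩
  rw [coordTransform_sub h hs ht, hζ', interval_average_eq_div, mul_assoc,
    div_mul_cancel₀ _ (sub_ne_zero.2 hst.ne')]

theorem strictMonoOn_coordTransform (ha : 0 < a)
    (h : ContinuousOn (diagMixedPartial R g) (Icc c e))
    (hpos : ∀ z ∈ Icc c e, 0 < diagMixedPartial R g z) :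
    StrictMonoOn (coordTransform R a g c) (Icc c e) := by
  intro s hs t ht hst
  obtain ⟨ζ, hζ, hζ'⟩ := exists_coordTransform_sub_eq (a := a) h hs ht hst
  have h1 := hpos ζ ⟨hs.1.trans hζ.1, hζ.2.trans ht.2⟩
  have : 0 < √a * √(diagMixedPartial R g ζ) * (t - s) :=
    mul_pos (mul_pos (Real.sqrt_pos.2 ha) (Real.sqrt_pos.2 h1)) (sub_pos.2 hst)
  linarith

theorem continuousOn_coordTransform (h : ContinuousOn (diagMixedPartial R g) (Icc c e)) :
    ContinuousOn (coordTransform R a g c) (Icc c e) := by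
  rcases lt_or_ge e c with hce | hce
  · simp [Icc_eq_empty_of_lt hce]
  refine continuousOn_const.mul ?_
  have := intervalIntegral.continuousOn_primitive_interval (μ := volume) (a := c) (b := e)
    (f := fun ξ => √(diagMixedPartial R g ξ))
    (by rw [uIcc_of_le hce]; exact h.sqrt.integrableOn_Icc)
  rwa [uIcc_of_le hce] at this

/-- The increments of the coordinate transformation are asymptotic, uniformly, to the increments of
the feature map of the one-dimensional kernel. -/
theorem exists_delta_coordTransform (hR : 0 < R) (ha : 0 < a) (hce : Icc c e ⊆ Icc (-R) R)
    (hsymm : ∀ x ∈ Icc (-R) R, ∀ y ∈ Icc (-R) R, g x y = g y x)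
    (hg : ContDiffOn ℝ 2 (fun p : ℝ × ℝ => g p.1 p.2) (Icc (-R) R ×ˢ Icc (-R) R))
    (hpos : ∀ z ∈ Icc c e, 0 < diagMixedPartial R g z) {ε : ℝ} (hε : 0 < ε) :
    ∃ δ > 0, ∀ s ∈ Icc c e, ∀ t ∈ Icc c e, dist s t < δ →
      a * (g s s + g t t - 2 * g s t) ≤
        (1 + ε) * (coordTransform R a g c s - coordTransform R a g c t) ^ 2 ∧
      (coordTransform R a g c s - coordTransform R a g c t) ^ 2 ≤
        (1 + ε) * (a * (g s s + g t t - 2 * g s t)) := by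
  have hu : UniqueDiffOn ℝ (Icc (-R) R) := uniqueDiffOn_Icc (by linarith)
  have hdiag := (continuousOn_diagMixedPartial hR hg).mono hce
  have hM := (continuousOn_mixedPartialWithin hu hg).mono (prod_mono hce hce)
  rcases lt_or_ge e c with hlt | hle
  · exact ⟨1, one_pos, by simp [Icc_eq_empty_of_lt hlt]⟩
  obtain ⟨z₀, hz₀, hmin⟩ := isCompact_Icc.exists_isMinOn (nonempty_Icc.2 hle) hdiag
  set m := diagMixedPartial R g z₀ with hm
  have hm0 : 0 < m := hpos z₀ hz₀
  -- The minimum `m > 0` turns absolute closeness into relative closeness. From `|A - B| ≤ B ε / (1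
  -- + ε)` follow both `A ≤ (1 + ε) B` and `B ≤ (1 + ε) A`.
  obtain ⟨δ, hδ, hδ'⟩ := Metric.uniformContinuousOn_iff.1
    ((isCompact_Icc.prod isCompact_Icc).uniformContinuousOn_of_continuous hM)
    (m * (ε / (1 + ε))) (by positivity)
  refine ⟨δ, hδ, ?_⟩
  have main : ∀ s ∈ Icc c e, ∀ t ∈ Icc c e, s < t → dist s t < δ →
      a * (g s s + g t t - 2 * g s t) ≤
        (1 + ε) * (coordTransform R a g c s - coordTransform R a g c t) ^ 2 ∧
      (coordTransform R a g c s - coordTransform R a g c t) ^ 2 ≤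
        (1 + ε) * (a * (g s s + g t t - 2 * g s t)) := by
    intro s hs t ht hst hd
    have hsub : Icc s t ⊆ Icc c e := Icc_subset_Icc hs.1 ht.2
    obtain ⟨ξ, hξ, η, hη, hD⟩ := exists_mixedPartialWithin_eq hu hg hst (hsub.trans hce)
    obtain ⟨ζ, hζ, hT⟩ := exists_coordTransform_sub_eq (a := a) hdiag hs ht hst
    have hclose : ∀ p ∈ Icc s t, dist p ζ < δ := fun p hp =>
      (Real.dist_le_of_mem_Icc hp hζ).trans_lt (by
        rwa [dist_comm, Real.dist_eq, abs_of_pos (sub_pos.2 hst)] at hd)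
    have hnear := hδ' (ξ, η) ⟨hsub hξ, hsub hη⟩ (ζ, ζ) ⟨hsub hζ, hsub hζ⟩
      (max_lt (hclose ξ hξ) (hclose η hη))
    set A := mixedPartialWithin (Icc (-R) R) g (ξ, η)
    have hB : mixedPartialWithin (Icc (-R) R) g (ζ, ζ) = diagMixedPartial R g ζ := rfl
    have hmB : m ≤ diagMixedPartial R g ζ := hmin (hsub hζ)
    rw [hB, Real.dist_eq] at hnear
    set B := diagMixedPartial R g ζ
    have hle : |A - B| ≤ B * (ε / (1 + ε)) := hnear.le.trans (by gcongr)
    have hAB := abs_le.1 hle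
    have hB0 : 0 < B := hm0.trans_le hmB
    have hr : ε / (1 + ε) ≤ ε := div_le_self hε.le (by linarith)
    have h1 : A ≤ (1 + ε) * B := by nlinarith [hAB.2]
    have h2 : B ≤ (1 + ε) * A := by
      have : (1 + ε) * (B - B * (ε / (1 + ε))) = B := by field_simp; ring
      nlinarith [hAB.1]
    have hD' : a * (g s s + g t t - 2 * g s t) = a * (t - s) ^ 2 * A := by
      rw [mul_assoc, ← hD, hsymm t (hce ht) s (hce hs)]; ring
    have hT' : (coordTransform R a g c s - coordTransform R a g c t) ^ 2 = a * (t - s) ^ 2 * B := by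
      rw [← neg_sub, neg_sq, hT, mul_pow, mul_pow, Real.sq_sqrt ha.le, Real.sq_sqrt hB0.le]; ring
    rw [hD', hT']
    have hk : 0 ≤ a * (t - s) ^ 2 := by positivity
    constructor <;> nlinarith
  intro s hs t ht hd
  rcases lt_trichotomy s t with hst | rfl | hst
  · exact main s hs t ht hst hd
  · have : g s s + g s s - 2 * g s s = 0 := by ring
    simp [this]
  · have := main t ht s hs hst (by rwa [dist_comm])
    rw [hsymm s (hce hs) t (hce ht), add_comm (g s s), sub_sq_comm]
    exact this

end CoordTransform

/-! ### The kernel as an inner product of features -/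

namespace MercerExpansion

variable {d : ℕ} {R : ℝ} {f : EuclideanSpace ℝ (Fin d) → EuclideanSpace ℝ (Fin d) → ℝ}

/-- Absolute convergence identifies the unordered sum in the `ℓ₂` inner product with the limit of
partial sums, which is `f`. -/
theorem inner_featureMap (m : MercerExpansion R f)
    (x y : closedBall (0 : EuclideanSpace ℝ (Fin d)) R) :
    inner ℝ (m.featureMap x) (m.featureMap y) = f x y := by
  have h1 : Tendsto (fun n => ∑ k ∈ Finset.range n, m.eig k * m.u k x * m.u k y) atTop
      (𝓝 (f x y)) :=
    m.tendstoUniformlyOn.tendsto_at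
      (x := ((x : EuclideanSpace ℝ (Fin d)), (y : EuclideanSpace ℝ (Fin d)))) ⟨x.2, y.2⟩
  have h2 := (m.summable_abs x x.2 y y.2).of_abs.hasSum.tendsto_sum_nat
  rw [lp.inner_eq_tsum, tendsto_nhds_unique h1 h2]
  refine tsum_congr fun k => ?_
  simp only [featureMap, RCLike.inner_apply, conj_trivial]
  linear_combination (m.u k x * m.u k y) * Real.mul_self_sqrt (m.eig_nonneg k)

theorem dist_featureMap_sq (m : MercerExpansion R f)
    (x y : closedBall (0 : EuclideanSpace ℝ (Fin d)) R) :
    dist (m.featureMap x) (m.featureMap y) ^ 2 = f x x + f y y - f x y - f y x := by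
  rw [dist_eq_norm, ← real_inner_self_eq_norm_sq, inner_sub_left, inner_sub_right, inner_sub_right]
  simp only [inner_featureMap]
  ring

end MercerExpansion

/-! ### Geometry of the box -/

section Box

variable {d : ℕ} {R : ℝ} {cm cp : Fin d → ℝ}

theorem intervalBox_eq_preimage (cm cp : Fin d → ℝ) :
    intervalBox cm cp = EuclideanSpace.equiv (Fin d) ℝ ⁻¹' Icc cm cp := by
  ext z
  simp [intervalBox, Pi.le_def, forall_and]

theorem isCompact_intervalBox (cm cp : Fin d → ℝ) : IsCompact (intervalBox cm cp) := by
  rw [intervalBox_eq_preimage]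
  exact (EuclideanSpace.equiv (Fin d) ℝ).toHomeomorph.isCompact_preimage.2 isCompact_Icc

theorem convex_intervalBox (cm cp : Fin d → ℝ) : Convex ℝ (intervalBox cm cp) := by
  rw [intervalBox_eq_preimage]
  exact (convex_Icc cm cp).linear_preimage (EuclideanSpace.equiv (Fin d) ℝ).toLinearMap

theorem apply_mem_Icc_of_mem_closedBall {x : EuclideanSpace ℝ (Fin d)} (hx : x ∈ closedBall 0 R)
    (i : Fin d) : x i ∈ Icc (-R) R :=
  abs_le.1 ((PiLp.norm_apply_le x i).trans (mem_closedBall_zero_iff.1 hx))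

/-- The two extreme corners of the box lie in the ball, which bounds all endpoints. -/
theorem Icc_subset_of_intervalBox_subset (hc : ∀ i, cm i ≤ cp i)
    (hZ : intervalBox cm cp ⊆ closedBall 0 R) (i : Fin d) :
    Icc (cm i) (cp i) ⊆ Icc (-R) R :=
  Icc_subset_Icc
    (apply_mem_Icc_of_mem_closedBall (hZ (show WithLp.toLp 2 cm ∈ _ from
      fun j => ⟨le_rfl, hc j⟩)) i).1
    (apply_mem_Icc_of_mem_closedBall (hZ (show WithLp.toLp 2 cp ∈ _ from
      fun j => ⟨hc j, le_rfl⟩)) i).2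

/-- Applying increasing continuous functions coordinatewise maps a box onto a box. -/
theorem convex_range_coordinatewise {T : Fin d → ℝ → ℝ}
    (hmono : ∀ i, MonotoneOn (T i) (Icc (cm i) (cp i)))
    (hcont : ∀ i, ContinuousOn (T i) (Icc (cm i) (cp i))) (hc : ∀ i, cm i ≤ cp i) :
    Convex ℝ (range fun z : intervalBox cm cp =>
      (WithLp.toLp 2 fun i => T i ((z : EuclideanSpace ℝ (Fin d)) i) :
        EuclideanSpace ℝ (Fin d))) := by
  convert convex_intervalBox (fun i => T i (cm i)) (fun i => T i (cp i))
  refine Subset.antisymm ?_ fun y hy => ?_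
  · rintro _ ⟨z, rfl⟩ i
    exact ⟨hmono i ⟨le_rfl, hc i⟩ (z.2 i) (z.2 i).1, hmono i (z.2 i) ⟨hc i, le_rfl⟩ (z.2 i).2⟩
  · choose x hx hxy using fun i => intermediate_value_Icc (hc i) (hcont i) (hy i)
    exact ⟨⟨WithLp.toLp 2 x, hx⟩, by ext i; exact hxy i⟩

theorem manifold_eq_range {f : EuclideanSpace ℝ (Fin d) → EuclideanSpace ℝ (Fin d) → ℝ}
    (m : MercerExpansion R f) (hZ : intervalBox cm cp ⊆ closedBall 0 R) :
    m.manifold (intervalBox cm cp) =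
      range fun z : intervalBox cm cp => m.featureMap ⟨z, hZ z.2⟩ := by
  ext p
  constructor
  · rintro ⟨x, hx, rfl⟩
    exact ⟨⟨x, hx⟩, rfl⟩
  · rintro ⟨z, rfl⟩
    exact ⟨_, z.2, rfl⟩

/-- Both comparison bounds apply with the inclusion in the roles of `φ` and `ψ`. -/
theorem geodesicDist_intervalBox {z w : EuclideanSpace ℝ (Fin d)} (hz : z ∈ intervalBox cm cp)
    (hw : w ∈ intervalBox cm cp) :
    geodesicDist (intervalBox cm cp) z w = edist z w := by
  have : CompactSpace (intervalBox cm cp) :=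
    isCompact_iff_compactSpace.1 (isCompact_intervalBox cm cp)
  have hr : range (Subtype.val : intervalBox cm cp → EuclideanSpace ℝ (Fin d)) =
      intervalBox cm cp := Subtype.range_coe
  have h : ∀ ε : ℝ, 0 < ε → ∃ δ > 0, ∀ x y : intervalBox cm cp, dist x y < δ →
      dist (x : EuclideanSpace ℝ (Fin d)) y ≤ (1 + ε) * dist (x : EuclideanSpace ℝ (Fin d)) y :=
    fun ε hε => ⟨1, one_pos, fun x y _ => le_mul_of_one_le_left dist_nonneg (by linarith)⟩
  have h1 := geodesicDist_range_le_edist continuous_subtype_val continuous_subtype_val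
    Subtype.val_injective (by rw [hr]; exact convex_intervalBox cm cp) h ⟨z, hz⟩ ⟨w, hw⟩
  have h2 := edist_le_geodesicDist_range continuous_subtype_val
    Subtype.val_injective h ⟨z, hz⟩ ⟨w, hw⟩
  rw [hr] at h1 h2
  exact le_antisymm h1 h2

end Box

/-! ### The additive kernel -/

section Kernel

variable {d : ℕ} {R : ℝ} {cm cp : Fin d → ℝ} {α : Fin d → ℝ} {f : Fin d → ℝ → ℝ → ℝ}

/-- The feature map and the coordinatewise transformation are infinitesimally isometric. -/
theorem exists_delta_dist_featureMap_transform (hR : 0 < R) (hc : ∀ i, cm i ≤ cp i)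
    (hZ : intervalBox cm cp ⊆ closedBall 0 R) (hα : ∀ i, 0 < α i)
    (hsymm : ∀ i, ∀ x ∈ Icc (-R) R, ∀ y ∈ Icc (-R) R, f i x y = f i y x)
    (hf_C2 : ∀ i, ContDiffOn ℝ 2 (fun p : ℝ × ℝ => f i p.1 p.2) (Icc (-R) R ×ˢ Icc (-R) R))
    (hf_pos : ∀ i, ∀ z ∈ Icc (cm i) (cp i), 0 < diagMixedPartial R (f i) z)
    (m : MercerExpansion R (additiveKernel α f)) {ε : ℝ} (hε : 0 < ε) :
    ∃ δ > 0, ∀ x y : intervalBox cm cp, dist x y < δ →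
      dist (m.featureMap ⟨x, hZ x.2⟩) (m.featureMap ⟨y, hZ y.2⟩) ≤
        (1 + ε) * dist (transform R α f cm x) (transform R α f cm y) ∧
      dist (transform R α f cm x) (transform R α f cm y) ≤
        (1 + ε) * dist (m.featureMap ⟨x, hZ x.2⟩) (m.featureMap ⟨y, hZ y.2⟩) := by
  have hsub := Icc_subset_of_intervalBox_subset hc hZ
  choose δ hδ hδ' using fun i => exists_delta_coordTransform hR (hα i) (hsub i) (hsymm i)
    (hf_C2 i) (hf_pos i) hε
  obtain ⟨δ₀, hδ₀, hle⟩ : ∃ δ₀ > 0, ∀ i, δ₀ ≤ δ i := by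
    rcases isEmpty_or_nonempty (Fin d) with h | h
    · exact ⟨1, one_pos, fun i => h.elim i⟩
    · obtain ⟨i, hi⟩ := Finite.exists_min δ
      exact ⟨δ i, hδ i, hi⟩
  refine ⟨δ₀, hδ₀, fun x y hxy => ?_⟩
  have hcoord := fun i => hδ' i _ (x.2 i) _ (y.2 i)
    (((PiLp.dist_apply_le (x : EuclideanSpace ℝ (Fin d)) y i).trans_lt hxy).trans_le (hle i))
  have hφ : dist (m.featureMap ⟨x, hZ x.2⟩) (m.featureMap ⟨y, hZ y.2⟩) ^ 2 =
      ∑ i, α i * (f i ((x : EuclideanSpace ℝ (Fin d)) i) ((x : EuclideanSpace ℝ (Fin d)) i) +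
        f i ((y : EuclideanSpace ℝ (Fin d)) i) ((y : EuclideanSpace ℝ (Fin d)) i) -
        2 * f i ((x : EuclideanSpace ℝ (Fin d)) i) ((y : EuclideanSpace ℝ (Fin d)) i)) := by
    rw [m.dist_featureMap_sq]
    simp only [additiveKernel, ← Finset.sum_add_distrib, ← Finset.sum_sub_distrib]
    refine Finset.sum_congr rfl fun i _ => ?_
    rw [hsymm i _ (hsub i (y.2 i)) _ (hsub i (x.2 i))]
    ring
  have hψ : dist (transform R α f cm x) (transform R α f cm y) ^ 2 =
      ∑ i, (coordTransform R (α i) (f i) (cm i) ((x : EuclideanSpace ℝ (Fin d)) i) -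
        coordTransform R (α i) (f i) (cm i) ((y : EuclideanSpace ℝ (Fin d)) i)) ^ 2 := by
    rw [EuclideanSpace.dist_sq_eq]
    exact Finset.sum_congr rfl fun i _ => by rw [Real.dist_eq, sq_abs]; rfl
  -- The squared bound loses nothing because `1 + ε ≤ (1 + ε)²`.
  have key : ∀ {p q : ℝ}, 0 ≤ q → p ^ 2 ≤ (1 + ε) * q ^ 2 → p ≤ (1 + ε) * q := by
    intro p q hq h
    refine le_of_sq_le_sq ?_ (by positivity)
    nlinarith [mul_nonneg (mul_nonneg hε.le (by linarith : 0 ≤ 1 + ε)) (sq_nonneg q)]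
  refine ⟨key dist_nonneg ?_, key dist_nonneg ?_⟩ <;>
  · rw [hφ, hψ, Finset.mul_sum]
    exact Finset.sum_le_sum fun i _ => by first | exact (hcoord i).1 | exact (hcoord i).2

theorem geodesicDist_manifold (hR : 0 < R) (hc : ∀ i, cm i ≤ cp i)
    (hZ : intervalBox cm cp ⊆ closedBall 0 R) (hα : ∀ i, 0 < α i)
    (hsymm : ∀ i, ∀ x ∈ Icc (-R) R, ∀ y ∈ Icc (-R) R, f i x y = f i y x)
    (hf_C2 : ∀ i, ContDiffOn ℝ 2 (fun p : ℝ × ℝ => f i p.1 p.2) (Icc (-R) R ×ˢ Icc (-R) R))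
    (hf_pos : ∀ i, ∀ z ∈ Icc (cm i) (cp i), 0 < diagMixedPartial R (f i) z)
    (hinj : ∀ x ∈ intervalBox cm cp, ∀ y ∈ intervalBox cm cp, x ≠ y →
      ∃ a ∈ intervalBox cm cp, additiveKernel α f x a ≠ additiveKernel α f y a)
    (m : MercerExpansion R (additiveKernel α f)) {z w : EuclideanSpace ℝ (Fin d)}
    (hz : z ∈ intervalBox cm cp) (hw : w ∈ intervalBox cm cp) :
    geodesicDist (m.manifold (intervalBox cm cp))
        (m.featureMap ⟨z, hZ hz⟩) (m.featureMap ⟨w, hZ hw⟩) =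
      edist (transform R α f cm z) (transform R α f cm w) := by
  have : CompactSpace (intervalBox cm cp) :=
    isCompact_iff_compactSpace.1 (isCompact_intervalBox cm cp)
  have hsub := Icc_subset_of_intervalBox_subset hc hZ
  have hdiag := fun i => (continuousOn_diagMixedPartial hR (hf_C2 i)).mono (hsub i)
  have hmono := fun i => strictMonoOn_coordTransform (hα i) (hdiag i) (hf_pos i)
  have hcont := fun i => continuousOn_coordTransform (a := α i) (hdiag i)
  set φ : intervalBox cm cp → EllTwo := fun x => m.featureMap ⟨x, hZ x.2⟩ with hφ
  set ψ : intervalBox cm cp → EuclideanSpace ℝ (Fin d) := fun x => transform R α f cm x with hψ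
  have hψc : Continuous ψ := by
    refine (PiLp.continuous_toLp 2 _).comp (continuous_pi fun i => ?_)
    exact (hcont i).comp_continuous (by fun_prop) fun x => x.2 i
  have hψi : Function.Injective ψ := fun x y h => by
    refine Subtype.ext (PiLp.ext fun i => (hmono i).injOn (x.2 i) (y.2 i) ?_)
    exact congrArg (fun v : EuclideanSpace ℝ (Fin d) => v i) h
  -- Pairing `φ x = φ y` with `φ a` gives `f x a = f y a`, against the separation of points.
  have hφi : Function.Injective φ := fun x y h => by
    by_contra hne
    obtain ⟨a, ha, hxy⟩ := hinj x x.2 y y.2 fun h' => hne (Subtype.ext h')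
    refine hxy ?_
    have hx := m.inner_featureMap ⟨x, hZ x.2⟩ ⟨a, hZ ha⟩
    have hy := m.inner_featureMap ⟨y, hZ y.2⟩ ⟨a, hZ ha⟩
    exact hx.symm.trans ((congrArg (fun v => inner ℝ v (m.featureMap ⟨a, hZ ha⟩)) h).trans hy)
  have hiso := fun ε (hε : 0 < ε) =>
    exists_delta_dist_featureMap_transform hR hc hZ hα hsymm hf_C2 hf_pos m hε
  -- Continuity of the eigenfunctions is not assumed; the comparison with `ε = 1` transfers
  -- continuity from `ψ` to `φ`.
  have hφc : Continuous φ := by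
    obtain ⟨δ, hδ, h⟩ := hiso 1 one_pos
    refine continuous_iff_continuousAt.2 fun y => tendsto_iff_dist_tendsto_zero.2 ?_
    have h0 : Tendsto (fun x => (1 + 1) * dist (ψ x) (ψ y)) (𝓝 y) (𝓝 ((1 + 1) * 0)) :=
      (tendsto_iff_dist_tendsto_zero.1 (hψc.tendsto y)).const_mul _
    rw [mul_zero] at h0
    refine squeeze_zero' (Eventually.of_forall fun _ => dist_nonneg) ?_ h0
    filter_upwards [Metric.ball_mem_nhds y hδ] with x hx using (h x y hx).1
  rw [manifold_eq_range m hZ]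
  refine le_antisymm ?_ ?_
  · exact geodesicDist_range_le_edist hφc hψc hψi
      (convex_range_coordinatewise (fun i => (hmono i).monotoneOn) hcont hc)
      (fun ε hε => (hiso ε hε).imp fun δ h => ⟨h.1, fun x y hxy => (h.2 x y hxy).1⟩)
      ⟨z, hz⟩ ⟨w, hw⟩
  · exact edist_le_geodesicDist_range hφc hφi
      (fun ε hε => (hiso ε hε).imp fun δ h => ⟨h.1, fun x y hxy => (h.2 x y hxy).2⟩)
      ⟨z, hz⟩ ⟨w, hw⟩

/-- If the speed of every coordinate is the constant `√c`, the transformation is a similarity. -/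
theorem norm_transform_sub_of_eq_const {c : ℝ} (hα : ∀ i, 0 < α i)
    (hdiag : ∀ i, ContinuousOn (diagMixedPartial R (f i)) (Icc (cm i) (cp i)))
    (hconst : ∀ i, ∀ z ∈ Icc (cm i) (cp i), α i * diagMixedPartial R (f i) z = c)
    {z w : EuclideanSpace ℝ (Fin d)}
    (hz : z ∈ intervalBox cm cp) (hw : w ∈ intervalBox cm cp) :
    ‖transform R α f cm z - transform R α f cm w‖ = √c * ‖z - w‖ := by
  have h : transform R α f cm z - transform R α f cm w = √c • (z - w) := by
    ext i
    change coordTransform R (α i) (f i) (cm i) (z i) - coordTransform R (α i) (f i) (cm i) (w i) =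
      √c * (z i - w i)
    -- Once `√αᵢ` is moved under the integral, the integrand is the constant `√c`.
    rw [coordTransform_sub (hdiag i) (hw i) (hz i), ← intervalIntegral.integral_const_mul,
      intervalIntegral.integral_congr (g := fun _ => √c), intervalIntegral.integral_const,
      smul_eq_mul, mul_comm]
    intro ξ hξ
    change √(α i) * √(diagMixedPartial R (f i) ξ) = √c
    rw [← Real.sqrt_mul (hα i).le, hconst i ξ (ordConnected_Icc.uIcc_subset (hw i) (hz i) hξ)]
  rw [h, norm_smul, Real.norm_of_nonneg (Real.sqrt_nonneg c)]

end Kernel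



theorem proposition4 (d : ℕ) (hd : 1 ≤ d) (R : ℝ) (hR : 0 < R)
    (cm cp : Fin d → ℝ) (hc : ∀ i, cm i ≤ cp i)
    (hZ : intervalBox cm cp ⊆ closedBall 0 R)
    (α : Fin d → ℝ) (hα : ∀ i, 0 < α i)
    (f : Fin d → ℝ → ℝ → ℝ)
    (hf_pd : ∀ i, IsPosDefKernelOn (Icc (-R) R) (f i))
    (hf_C2 : ∀ i, ContDiffOn ℝ 2 (fun p : ℝ × ℝ => f i p.1 p.2) (Icc (-R) R ×ˢ Icc (-R) R))
    (hf_pos : ∀ i, ∀ z ∈ Icc (cm i) (cp i), 0 < diagMixedPartial R (f i) z)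
    (hinj : ∀ x ∈ intervalBox cm cp, ∀ y ∈ intervalBox cm cp, x ≠ y →
      ∃ a ∈ intervalBox cm cp, additiveKernel α f x a ≠ additiveKernel α f y a)
    (m : MercerExpansion R (additiveKernel α f)) :
    (∀ i, StrictMonoOn (coordTransform R (α i) (f i) (cm i)) (Icc (cm i) (cp i))) ∧
    (∀ (z w : EuclideanSpace ℝ (Fin d)) (hz : z ∈ intervalBox cm cp)
        (hw : w ∈ intervalBox cm cp),
      geodesicDist (m.manifold (intervalBox cm cp))
          (m.featureMap ⟨z, hZ hz⟩) (m.featureMap ⟨w, hZ hw⟩) =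
        ENNReal.ofReal ‖transform R α f cm z - transform R α f cm w‖) ∧
    (∀ c : ℝ, 0 < c →
      (∀ i, ∀ z ∈ Icc (cm i) (cp i), α i * diagMixedPartial R (f i) z = c) →
      ∀ (z w : EuclideanSpace ℝ (Fin d)) (hz : z ∈ intervalBox cm cp)
          (hw : w ∈ intervalBox cm cp),
        geodesicDist (m.manifold (intervalBox cm cp))
            (m.featureMap ⟨z, hZ hz⟩) (m.featureMap ⟨w, hZ hw⟩) =
          ENNReal.ofReal (√c) * geodesicDist (intervalBox cm cp) z w ∧
        geodesicDist (intervalBox cm cp) z w = ENNReal.ofReal ‖z - w‖) := by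
  have hsymm := fun i => (hf_pd i).1
  have hdiag := fun i => (continuousOn_diagMixedPartial hR (hf_C2 i)).mono
    (Icc_subset_of_intervalBox_subset hc hZ i)
  have hgeo : ∀ (z w : EuclideanSpace ℝ (Fin d)) (hz : z ∈ intervalBox cm cp)
      (hw : w ∈ intervalBox cm cp),
      geodesicDist (m.manifold (intervalBox cm cp))
          (m.featureMap ⟨z, hZ hz⟩) (m.featureMap ⟨w, hZ hw⟩) =
        ENNReal.ofReal ‖transform R α f cm z - transform R α f cm w‖ := fun z w hz hw => by
    rw [geodesicDist_manifold hR hc hZ hα hsymm hf_C2 hf_pos hinj m hz hw, edist_dist,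
      dist_eq_norm]
  refine ⟨fun i => strictMonoOn_coordTransform (hα i) (hdiag i) (hf_pos i), hgeo,
    fun c _ hconst z w hz hw => ?_⟩
  have hbox : geodesicDist (intervalBox cm cp) z w = ENNReal.ofReal ‖z - w‖ := by
    rw [geodesicDist_intervalBox hz hw, edist_dist, dist_eq_norm]
  refine ⟨?_, hbox⟩
  rw [hgeo z w hz hw, hbox, norm_transform_sub_of_eq_const hα hdiag hconst hz hw,
    ENNReal.ofReal_mul (Real.sqrt_nonneg c)]
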